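/- Let $G$ be a finite digraph (loops and parallel edges are allowed) with vertex set $V(G)$ and edge set $E(G)$, each edge $e$ having a tail $t(e)$ and a head $h(e)$ in $V(G)$. Let the edges be weighted by elements $w_e$ of a commutative ring, for example by independent indeterminates. For a vertex $v$ let $d_v^-(G)$ be the number of edges with head $v$, and let $d_v(G)=\sum_{e\in E(G),\,t(e)=v}w_e$. An oriented spanning tree of a digraph with root $u$ is a spanning tree (of the underlying undirected graph) in which $u$ has outdegree $0$ and every other vertex has outdegree $1$; $t_u(G)=\sum_T\prod_{e\in E(T)}w_e$ denotes the sum over all oriented spanning trees $T$ of $G$ with root $u$. The line digraph $\mathcal{L}(G)$ has vertex set $E(G)$ and exactly one edge from $e$ to $f$ if $h(e)=t(f)$, and none otherwise; the edge from $e$ to $f$ has weight $w_f$, and $t_e(\mathcal{L}(G))$ is formed with these weights. If $d_v^-(G)>0$ for every $v\in V(G)$, then $$\sum_{e\in E(G)}t_e(\mathcal{L}(G))=\prod_{v\in V(G)}d_v(G)^{d_v^-(G)-1}\,\sum_{v\in V(G)}t_v(G),$$ where $x^0=1$ for every $x$, including $x=0$. -/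

import Mathlib

/-- A digraph with vertex type `V` and edge type `E`: each edge has a tail and a head.
Loops and parallel edges are allowed; a digraph without parallel edges is the case in which
`e ↦ (tail e, head e)` is injective. -/
structure MultiDigraph (V E : Type*) where
  tail : E → V
  head : E → V

namespace MultiDigraph

/-- The indegree of `v`: the number of edges with head `v`. -/
def indegree {V E : Type*} [DecidableEq V] [Fintype E] (G : MultiDigraph V E) (v : V) : ℕ :=
  (Finset.univ.filter fun e => G.head e = v).card

/-- The weighted degree of `v`: the sum of the weights of the edges with tail `v`. -/
def weightedDegree {V E R : Type*} [DecidableEq V] [Fintype E] [CommRing R]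
    (G : MultiDigraph V E) (w : E → R) (v : V) : R :=
  ∑ e ∈ Finset.univ.filter (fun e => G.tail e = v), w e

/-- The edge set `T`, with directions forgotten, is a tree containing all vertices: it has no
loops, no two of its edges have the same pair of ends, and the resulting simple graph on the
whole vertex set is a tree (connected and acyclic). -/
structure IsSpanningTree {V E : Type*} (G : MultiDigraph V E) (T : Finset E) : Prop where
  loopless : ∀ e ∈ T, G.tail e ≠ G.head e
  injOn_ends : Set.InjOn (fun e => s(G.tail e, G.head e)) (T : Set E)
  isTree : (SimpleGraph.fromEdgeSet ((fun e => s(G.tail e, G.head e)) '' (T : Set E))).IsTree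

/-- `T` is (the edge set of) an oriented spanning tree with root `u`: a spanning tree in which
`u` has outdegree `0` and every other vertex has outdegree `1`. -/
structure IsOrientedSpanningTree {V E : Type*} [DecidableEq V] (G : MultiDigraph V E)
    (u : V) (T : Finset E) : Prop where
  isSpanningTree : G.IsSpanningTree T
  outdegree_root : (T.filter fun e => G.tail e = u).card = 0
  outdegree_of_ne : ∀ v, v ≠ u → (T.filter fun e => G.tail e = v).card = 1

open Classical in
/-- The spanning tree enumerator at `u`: the sum, over all oriented spanning trees `T` with
root `u`, of the product of the weights of the edges of `T`. -/
noncomputable def treeEnumerator {V E R : Type*} [DecidableEq V] [Fintype E] [CommRing R]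
    (G : MultiDigraph V E) (w : E → R) (u : V) : R :=
  ∑ T ∈ Finset.univ.filter (fun T : Finset E => G.IsOrientedSpanningTree u T), ∏ e ∈ T, w e

/-- The line digraph: its vertices are the edges of `G`, and there is exactly one edge from `e`
to `f` if the head of `e` is the tail of `f`, and none otherwise. -/
def lineDigraph {V E : Type*} (G : MultiDigraph V E) :
    MultiDigraph E {p : E × E // G.head p.1 = G.tail p.2} where
  tail p := p.1.1
  head p := p.1.2

/-- The edge weights induced by vertex weights `x`: every edge `uv` has the weight `x v`. -/
def inducedWeight {V E R : Type*} (G : MultiDigraph V E) (x : V → R) : E → R :=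
  fun e => x (G.head e)

end MultiDigraph

open Matrix Polynomial

/-! Let `L` be the weighted Laplacian. The constant coefficient of `det (X + L)` is `det L = 0`, and
its linear coefficient is the trace of the adjugate, which by the matrix-tree theorem
(`adjugate_laplacian_apply`) is the sum of the tree enumerators over all roots. So it suffices to
compare `det (X + L)` for `G` and its line digraph. With `q v = X + d_v`, the two matrices are `q -
W * H` and `q ∘ head - H * W`, where `H` and `W` are the head and weighted tail incidence matrices.
A block factorization then gives `laplacianPoly_lineDigraph`, whose linear coefficient is the
theorem. -/

theorem Function.exists_iterate_eq_iff {V : Type*} {p : V → V} {u v : V} (hv : v ≠ u) :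
    (∃ n : ℕ, p^[n] v = u) ↔ ∃ n : ℕ, p^[n] (p v) = u := by
  constructor
  · rintro ⟨_ | n, hn⟩
    · exact absurd hn hv
    · exact ⟨n, hn⟩
  · rintro ⟨n, hn⟩
    exact ⟨n + 1, hn⟩

/-- Take the number of steps needed to reach `u`. This rank makes the matrix of a self-map
triangular and later rules out loops and antiparallel chosen edges. -/
theorem Function.exists_rank_of_iterate_eq {V : Type*} {p : V → V} {u : V}
    (h : ∀ v, ∃ n : ℕ, p^[n] v = u) : ∃ d : V → ℕ, ∀ v, v ≠ u → d (p v) < d v := by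
  classical
  refine ⟨fun v => Nat.find (h v), fun v hv => ?_⟩
  have hs : p^[Nat.find (h v)] v = u := Nat.find_spec (h v)
  dsimp only
  generalize Nat.find (h v) = k at hs
  cases k with
  | zero => exact absurd hs hv
  | succ n => exact Nat.lt_succ_of_le (Nat.find_min' (h (p v)) hs)

/-- The determinant of `1 - P`, where `P` is the transition matrix of a self-map `p` with the row
of `u` removed: it is `1` if every vertex is eventually mapped to `u`, and `0` otherwise. -/
theorem Matrix.det_one_sub_of_self_map {V R : Type*} [Fintype V] [DecidableEq V] [CommRing R]
    (u : V) (p : V → V) [Decidable (∀ v, ∃ n : ℕ, p^[n] v = u)] :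
    (Matrix.of fun v : V => if v = u then Pi.single u (1 : R)
      else Pi.single v 1 - Pi.single (p v) 1).det =
      if ∀ v, ∃ n : ℕ, p^[n] v = u then 1 else 0 := by
  classical
  split_ifs with h
  · obtain ⟨d, hd⟩ := Function.exists_rank_of_iterate_eq h
    have hM : (Matrix.of fun v : V => if v = u then Pi.single u (1 : R)
        else Pi.single v 1 - Pi.single (p v) 1).BlockTriangular fun v => OrderDual.toDual (d v) := by
      intro i j hij
      have hij : d i < d j := hij
      have hji : j ≠ i := by rintro rfl; exact lt_irrefl _ hij
      rw [of_apply]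
      split_ifs with hi
      · subst hi
        simp [hji]
      · have : j ≠ p i := by
          rintro rfl
          exact lt_asymm hij (hd i hi)
        simp [hji, this]
    -- The blocks of constant rank are identity matrices, since `p i` has smaller rank than `i`.
    rw [hM.det]
    refine Finset.prod_eq_one fun a _ => ?_
    rw [← det_one (R := R) (n := {i // OrderDual.toDual (d i) = a})]
    congr 1
    ext ⟨i, hi⟩ ⟨j, hj⟩
    have hij : d i = d j := OrderDual.toDual.injective (hi.trans hj.symm)
    rw [toSquareBlock_def, of_apply, of_apply, one_apply]
    dsimp only
    by_cases hiu : i = u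
    · subst hiu
      simp [Pi.single_apply, eq_comm]
    · have : j ≠ p i := by
        rintro rfl
        exact (hd i hiu).ne hij.symm
      simp [hiu, this, Pi.single_apply, eq_comm]
  · push Not at h
    obtain ⟨v, hv⟩ := h
    -- The indicator of the vertices that never reach `u` lies in the kernel. Applying the adjugate
    -- gives `det • x = 0`, and `x` has an entry `1`.
    let x : V → R := fun v => if ∃ n : ℕ, p^[n] v = u then 0 else 1
    have hx : (Matrix.of fun v : V => if v = u then Pi.single u (1 : R)
        else Pi.single v 1 - Pi.single (p v) 1) *ᵥ x = 0 := by
      ext i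
      change (if i = u then Pi.single u (1 : R) else Pi.single i 1 - Pi.single (p i) 1) ⬝ᵥ x = 0
      split_ifs with hi
      · subst hi
        have : ∃ n : ℕ, p^[n] i = i := ⟨0, rfl⟩
        simp [x, this]
      · have := Function.exists_iterate_eq_iff (p := p) hi
        simp [x, sub_dotProduct, this]
    have hdet := congrFun (congrArg (mulVec (adjugate (Matrix.of fun v : V =>
      if v = u then Pi.single u (1 : R) else Pi.single v 1 - Pi.single (p v) 1))) hx) v
    have hxv : x v = 1 := if_neg (by simpa using hv)
    simpa [mulVec_mulVec, adjugate_mul, smul_mulVec, hxv] using hdet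

/-- The coefficient of `X` in `det (X + M)` is the trace of the adjugate of `M`. -/
theorem Matrix.coeff_one_det_X_add {V R : Type*} [Fintype V] [DecidableEq V] [CommRing R]
    (M : Matrix V V R) :
    (det (scalar V (X : R[X]) + M.map C)).coeff 1 = M.adjugate.trace := by
  -- Expand by rows: `s` is the set of rows taken from `X • 1`. Only singletons contribute to `X ^
  -- 1`, and they give the diagonal entries of the adjugate.
  let N : Finset V → Matrix V V R := fun s =>
    of fun i j => if i ∈ s then (1 : Matrix V V R) i j else M i j
  have hdet : det (scalar V (X : R[X]) + M.map C) =
      ∑ s : Finset V, X ^ s.card * C (det (N s)) := by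
    let A : V → V → R[X] := scalar V (X : R[X])
    let B : V → V → R[X] := M.map C
    refine ((detRowAlternating (n := V) (R := R[X])).map_add_univ A B).trans
      (Finset.sum_congr rfl fun s _ => ?_)
    let D : V → V → R[X] := (N s).map C
    have h := (detRowAlternating (n := V) (R := R[X])).toMultilinearMap.map_piecewise_smul
      (fun _ => X) D s
    rw [Finset.prod_const, smul_eq_mul] at h
    rw [RingHom.map_det]
    refine Eq.trans (congrArg detRowAlternating (funext fun i => funext fun j => ?_)) h
    by_cases hi : i ∈ s
    · rw [Finset.piecewise_eq_of_mem _ _ _ hi, Finset.piecewise_eq_of_mem _ _ _ hi]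
      by_cases hij : i = j
      · subst hij
        simp [A, D, N, hi]
      · simp [A, D, N, hi, hij]
    · rw [Finset.piecewise_eq_of_notMem _ _ _ hi, Finset.piecewise_eq_of_notMem _ _ _ hi]
      simp [B, D, N, hi]
  have hcoeff : ∀ s : Finset V, (X ^ s.card * C (det (N s))).coeff 1 =
      if s.card = 1 then det (N s) else 0 := by
    intro s
    rw [coeff_X_pow_mul', coeff_C]
    split_ifs <;> first | rfl | omega
  rw [hdet, finsetSum_coeff, trace]
  simp_rw [hcoeff]
  rw [← Finset.sum_filter, ← Finset.powerset_univ, ← Finset.powersetCard_eq_filter,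
    Finset.powersetCard_one, Finset.sum_map]
  refine Finset.sum_congr rfl fun u _ => ?_
  rw [diag_apply, adjugate_apply]
  congr 1
  ext i j
  by_cases h : i = u
  · subst h
    simp [N, one_apply, Pi.single_apply, eq_comm]
  · simp [N, h]

/-! ### The matrix-tree theorem -/

namespace MultiDigraph

section

variable {V E R : Type*} (G : MultiDigraph V E)

/-- The weighted Laplacian: the row of `v` is the sum of `w e • (v - head e)` over the edges `e`
with tail `v`. -/
def laplacian [DecidableEq V] [Fintype E] [CommRing R] (w : E → R) : Matrix V V R :=
  Matrix.of fun v => ∑ e ∈ Finset.univ.filter (fun e => G.tail e = v),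
    w e • (Pi.single v 1 - Pi.single (G.head e) 1)

/-- The vertex that follows `v` when the chosen edges are traversed. -/
def next (r : V → Option E) (v : V) : V := (r v).elim v G.head

/-- The set of edges chosen by `r`. -/
def chosenEdges [Fintype E] [DecidableEq E] (r : V → Option E) : Finset E :=
  Finset.univ.filter fun e => r (G.tail e) = some e

variable {G}

theorem mem_chosenEdges [Fintype E] [DecidableEq E] {r : V → Option E} {e : E} :
    e ∈ G.chosenEdges r ↔ r (G.tail e) = some e := by
  simp [chosenEdges]

theorem next_tail [Fintype E] [DecidableEq E] {r : V → Option E} {e : E} (he : e ∈ G.chosenEdges r) : G.next r (G.tail e) = G.head e := by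
  rw [next, mem_chosenEdges.1 he]
  rfl

/-- `r` chooses an edge with tail `v` for every vertex `v` other than `u`. -/
structure IsRootedChoice (u : V) (r : V → Option E) : Prop where
  root : r u = none
  exists_of_ne : ∀ v, v ≠ u → ∃ e, r v = some e ∧ G.tail e = v

namespace IsRootedChoice

variable [DecidableEq V] [Fintype E] [DecidableEq E] {u : V} {r : V → Option E}

theorem filter_root (h : G.IsRootedChoice u r) :
    (G.chosenEdges r).filter (fun e => G.tail e = u) = ∅ := by
  refine Finset.filter_eq_empty_iff.2 fun e he heu => ?_
  rw [mem_chosenEdges, heu, h.root] at he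
  cases he

theorem filter_of_eq_some (h : G.IsRootedChoice u r) {v : V} {e : E} (he : r v = some e) :
    (G.chosenEdges r).filter (fun e => G.tail e = v) = {e} := by
  have hv : v ≠ u := by
    rintro rfl
    rw [h.root] at he
    cases he
  obtain ⟨e', he', ht⟩ := h.exists_of_ne v hv
  obtain rfl : e = e' := Option.some_injective _ (he.symm.trans he')
  ext f
  simp only [Finset.mem_filter, mem_chosenEdges, Finset.mem_singleton]
  constructor
  · rintro ⟨hf, rfl⟩
    exact Option.some_injective _ (hf.symm.trans he)
  · rintro rfl
    exact ⟨ht.symm ▸ he, ht⟩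

theorem prod_chosenEdges [Fintype V] [CommRing R] (h : G.IsRootedChoice u r) (w : E → R) :
    ∏ e ∈ G.chosenEdges r, w e = ∏ v, (r v).elim 1 w := by
  rw [← Finset.prod_fiberwise (G.chosenEdges r) G.tail]
  refine Finset.prod_congr rfl fun v _ => ?_
  by_cases hv : v = u
  · subst hv
    rw [h.filter_root, h.root]
    rfl
  · obtain ⟨e, he, -⟩ := h.exists_of_ne v hv
    rw [h.filter_of_eq_some he, he, Finset.prod_singleton]
    rfl

theorem card_chosenEdges [Fintype V] (h : G.IsRootedChoice u r) :
    (G.chosenEdges r).card + 1 = Fintype.card V := by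
  rw [Finset.card_eq_sum_card_fiberwise (f := G.tail) (t := Finset.univ) (by simp),
    ← Finset.sum_erase_add _ _ (Finset.mem_univ u), h.filter_root, Finset.card_empty, add_zero,
    Finset.sum_congr rfl (g := fun _ => 1), Finset.sum_const, smul_eq_mul, mul_one,
    Finset.card_erase_add_one (Finset.mem_univ u), Finset.card_univ]
  intro v hv
  obtain ⟨e, he, -⟩ := h.exists_of_ne v (Finset.ne_of_mem_erase hv)
  rw [h.filter_of_eq_some he, Finset.card_singleton]

/-- In an oriented spanning tree every vertex is led to the root. -/
theorem reaches_of_isOrientedSpanningTree (h : G.IsRootedChoice u r)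
    (hT : G.IsOrientedSpanningTree u (G.chosenEdges r)) (v : V) :
    ∃ n : ℕ, (G.next r)^[n] v = u := by
  obtain ⟨p⟩ := hT.isSpanningTree.isTree.connected.preconnected v u
  induction p with
  | nil => exact ⟨0, rfl⟩
  | @cons a b c hab p ih =>
    have hb := ih h hT
    rw [SimpleGraph.fromEdgeSet_adj] at hab
    obtain ⟨⟨e, he, hs⟩, -⟩ := hab
    have he : e ∈ G.chosenEdges r := he
    have ht : G.tail e ≠ c := by
      intro ht
      have := h.filter_root
      rw [Finset.filter_eq_empty_iff] at this
      exact this he ht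
    have := Function.exists_iterate_eq_iff (p := G.next r) ht
    rw [next_tail he] at this
    -- The undirected path may cross `e` either way; reaching the root passes between tail and head
    -- in both directions.
    obtain ⟨rfl, rfl⟩ | ⟨rfl, rfl⟩ := Sym2.eq_iff.1 hs
    · exact this.2 hb
    · exact this.1 hb

/-- If every vertex is led to the root, then the chosen edges form an oriented spanning tree. -/
theorem isOrientedSpanningTree_of_reaches [Fintype V] (h : G.IsRootedChoice u r)
    (hr : ∀ v, ∃ n : ℕ, (G.next r)^[n] v = u) :
    G.IsOrientedSpanningTree u (G.chosenEdges r) := by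
  obtain ⟨d, hlt⟩ := Function.exists_rank_of_iterate_eq hr
  have hd : ∀ e ∈ G.chosenEdges r, d (G.head e) < d (G.tail e) := by
    intro e he
    rw [← next_tail he]
    refine hlt _ fun ht => ?_
    rw [mem_chosenEdges, ht, h.root] at he
    cases he
  have hloop : ∀ e ∈ G.chosenEdges r, G.tail e ≠ G.head e := fun e he hth =>
    (hd e he).ne (congrArg d hth.symm)
  have hinj : Set.InjOn (fun e => s(G.tail e, G.head e)) (G.chosenEdges r : Set E) := by
    intro e he f hf hef
    have he : e ∈ G.chosenEdges r := he
    have hf : f ∈ G.chosenEdges r := hf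
    obtain ⟨ht, -⟩ | ⟨ht, hh⟩ := Sym2.eq_iff.1 hef
    · rw [mem_chosenEdges] at he hf
      rw [ht, hf] at he
      exact (Option.some_injective _ he).symm
    · have h1 := hd e he
      have h2 := hd f hf
      rw [ht, hh] at h1
      exact absurd h1 h2.asymm
  refine ⟨⟨hloop, hinj, ?_⟩, by rw [h.filter_root, Finset.card_empty], fun v hv => ?_⟩
  · rw [SimpleGraph.isTree_iff_connected_and_card]
    constructor
    · have hreach : ∀ v, (SimpleGraph.fromEdgeSet ((fun e => s(G.tail e, G.head e)) ''
          (G.chosenEdges r : Set E))).Reachable v u := by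
        intro v
        obtain ⟨n, hn⟩ := hr v
        induction n generalizing v with
        | zero => exact hn ▸ SimpleGraph.Reachable.refl _
        | succ n ih =>
          by_cases hv : v = u
          · exact hv ▸ SimpleGraph.Reachable.refl _
          · obtain ⟨e, he, rfl⟩ := h.exists_of_ne v hv
            have he : e ∈ G.chosenEdges r := mem_chosenEdges.2 he
            rw [Function.iterate_succ_apply, next_tail he] at hn
            refine SimpleGraph.Reachable.trans (SimpleGraph.Adj.reachable ?_) (ih _ hn)
            rw [SimpleGraph.fromEdgeSet_adj]
            exact ⟨⟨e, he, rfl⟩, hloop e he⟩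
      have : Nonempty V := ⟨u⟩
      exact ⟨fun a b => (hreach a).trans (hreach b).symm⟩
    · have hdiff : ((fun e => s(G.tail e, G.head e)) '' (G.chosenEdges r : Set E)) \
          Sym2.diagSet = (fun e => s(G.tail e, G.head e)) '' (G.chosenEdges r : Set E) := by
        rw [sdiff_eq_left, Set.disjoint_left]
        rintro _ ⟨e, he, rfl⟩ hdiag
        exact hloop e he (by simpa using hdiag)
      rw [SimpleGraph.edgeSet_fromEdgeSet, hdiff, Nat.card_coe_set_eq, hinj.ncard_image,
        Set.ncard_coe_finset, h.card_chosenEdges, Nat.card_eq_fintype_card]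
  · obtain ⟨e, he, -⟩ := h.exists_of_ne v hv
    rw [h.filter_of_eq_some he, Finset.card_singleton]

theorem chosenEdges_injective {r' : V → Option E} (h : G.IsRootedChoice u r)
    (h' : G.IsRootedChoice u r') (heq : G.chosenEdges r = G.chosenEdges r') : r = r' := by
  ext1 v
  by_cases hv : v = u
  · subst hv
    rw [h.root, h'.root]
  · obtain ⟨e, he, rfl⟩ := h.exists_of_ne v hv
    have he' : e ∈ G.chosenEdges r := mem_chosenEdges.2 he
    rw [heq] at he'
    rw [he, mem_chosenEdges.1 he']

end IsRootedChoice

variable [DecidableEq V]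

theorem IsOrientedSpanningTree.exists_isRootedChoice [Fintype E] [DecidableEq E] {u : V}
    {T : Finset E} (hT : G.IsOrientedSpanningTree u T) :
    ∃ r, G.IsRootedChoice u r ∧ G.chosenEdges r = T := by
  classical
  have hex : ∀ v, v ≠ u → ∃ e, T.filter (fun e => G.tail e = v) = {e} := fun v hv =>
    Finset.card_eq_one.1 (hT.outdegree_of_ne v hv)
  choose f hf using hex
  have hmem : ∀ v hv e, (e ∈ T ∧ G.tail e = v) ↔ e = f v hv := by
    intro v hv e
    rw [← Finset.mem_filter (p := fun e => G.tail e = v), hf, Finset.mem_singleton]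
  refine ⟨fun v => if hv : v = u then none else some (f v hv), ⟨dif_pos rfl, fun v hv => ?_⟩, ?_⟩
  · exact ⟨f v hv, dif_neg hv, ((hmem v hv _).2 rfl).2⟩
  · ext e
    rw [mem_chosenEdges]
    by_cases hu : G.tail e = u
    · have : e ∉ T := fun he =>
        Finset.notMem_empty e (Finset.card_eq_zero.1 hT.outdegree_root ▸
          Finset.mem_filter.2 ⟨he, hu⟩)
      simp [hu, this]
    · rw [dif_neg hu, Option.some_inj, eq_comm, ← hmem]
      simp

variable (G)

/-- The matrix-tree theorem for weighted digraphs. -/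
theorem adjugate_laplacian_apply [Fintype V] [Fintype E] [DecidableEq E] [CommRing R] (w : E → R)
    (u : V) : (G.laplacian w).adjugate u u = G.treeEnumerator w u := by
  classical
  let A : V → Finset (Option E) := fun v => if v = u then {none} else
    (Finset.univ.filter fun e => G.tail e = v).map Function.Embedding.some
  have hA : ∀ r, r ∈ Fintype.piFinset A ↔ G.IsRootedChoice u r := by
    intro r
    rw [Fintype.mem_piFinset]
    constructor
    · intro h
      refine ⟨by simpa [A] using h u, fun v hv => ?_⟩
      have := h v
      simp only [A, if_neg hv, Finset.mem_map, Finset.mem_filter, Finset.mem_univ, true_and] at this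
      obtain ⟨e, he, hev⟩ := this
      exact ⟨e, hev.symm, he⟩
    · intro h v
      by_cases hv : v = u
      · subst hv
        simp [A, h.root]
      · obtain ⟨e, he, hev⟩ := h.exists_of_ne v hv
        simp [A, if_neg hv, he, hev]
  -- `none` encodes the unit row that replaces row `u`; expanding the other rows means choosing an
  -- out-edge at each vertex.
  let g : V → Option E → V → R := fun v o =>
    o.elim (Pi.single v 1) fun e => w e • (Pi.single v 1 - Pi.single (G.head e) 1)
  have hrows : (G.laplacian w).updateRow u (Pi.single u 1) = fun v => ∑ o ∈ A v, g v o := by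
    ext1 v
    by_cases hv : v = u
    · subst hv
      simp [A, g]
    · rw [updateRow_ne hv]
      simp [A, g, hv, laplacian]
  rw [adjugate_apply, hrows, treeEnumerator]
  refine ((detRowAlternating (n := V) (R := R)).toMultilinearMap.map_sum_finset g A).trans ?_
  have hterm : ∀ r ∈ Fintype.piFinset A,
      (detRowAlternating (n := V) (R := R)).toMultilinearMap (fun v => g v (r v)) =
        if ∀ v, ∃ n : ℕ, (G.next r)^[n] v = u then ∏ e ∈ G.chosenEdges r, w e else 0 := by
    intro r hr
    rw [hA] at hr
    let m : V → V → R := fun v =>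
      if v = u then Pi.single u (1 : R) else Pi.single v 1 - Pi.single (G.next r v) 1
    have hg : (fun v => g v (r v)) = fun v => (r v).elim 1 w • m v := by
      ext1 v
      by_cases hv : v = u
      · subst hv
        simp [g, m, hr.root]
      · obtain ⟨e, he, -⟩ := hr.exists_of_ne v hv
        simp [g, m, he, hv, next]
    rw [hg, MultilinearMap.map_smul_univ, ← hr.prod_chosenEdges, smul_eq_mul]
    refine (congrArg _ (Matrix.det_one_sub_of_self_map (R := R) u (G.next r))).trans ?_
    rw [mul_ite, mul_one, mul_zero]
  rw [Finset.sum_congr rfl hterm, ← Finset.sum_filter]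
  refine Finset.sum_bij (fun r _ => G.chosenEdges r) ?_ ?_ ?_ fun _ _ => rfl
  · intro r hr
    rw [Finset.mem_filter, hA] at hr
    exact Finset.mem_filter.2 ⟨Finset.mem_univ _, hr.1.isOrientedSpanningTree_of_reaches hr.2⟩
  · intro r hr r' hr' heq
    rw [Finset.mem_filter, hA] at hr hr'
    exact hr.1.chosenEdges_injective hr'.1 heq
  · intro T hT
    have hT := (Finset.mem_filter.1 hT).2
    obtain ⟨r, hr, rfl⟩ := hT.exists_isRootedChoice
    exact ⟨r, Finset.mem_filter.2 ⟨(hA r).2 hr, hr.reaches_of_isOrientedSpanningTree hT⟩, rfl⟩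

/-! ### The polynomial `det (X + L)` -/

theorem det_laplacian [Fintype V] [Nonempty V] [Fintype E] [CommRing R] (w : E → R) :
    (G.laplacian w).det = 0 := by
  have h : G.laplacian w *ᵥ 1 = 0 := by
    ext v
    change (∑ e ∈ Finset.univ.filter (fun e => G.tail e = v),
      w e • (Pi.single v 1 - Pi.single (G.head e) 1)) ⬝ᵥ (1 : V → R) = 0
    rw [sum_dotProduct]
    refine Finset.sum_eq_zero fun e _ => ?_
    simp [sub_dotProduct]
  obtain ⟨v⟩ := ‹Nonempty V›
  have := congrArg (fun y => ((G.laplacian w).adjugate *ᵥ y) v) h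
  simpa [mulVec_mulVec, adjugate_mul, smul_mulVec] using this

/-- The characteristic polynomial of the Laplacian, up to signs. -/
noncomputable def laplacianPoly [Fintype V] [Fintype E] [CommRing R] (w : E → R) : R[X] :=
  det (scalar V (X : R[X]) + (G.laplacian w).map C)

theorem coeff_zero_laplacianPoly [Fintype V] [Nonempty V] [Fintype E] [CommRing R] (w : E → R) :
    (G.laplacianPoly w).coeff 0 = 0 := by
  rw [laplacianPoly, coeff_zero_eq_eval_zero, ← coe_evalRingHom, RingHom.map_det]
  refine Eq.trans (congrArg det ?_) (G.det_laplacian w)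
  ext i j
  by_cases h : i = j <;> simp [h]

theorem coeff_one_laplacianPoly [Fintype V] [Fintype E] [DecidableEq E] [CommRing R] (w : E → R) :
    (G.laplacianPoly w).coeff 1 = ∑ v, G.treeEnumerator w v := by
  rw [laplacianPoly, coeff_one_det_X_add, trace]
  exact Finset.sum_congr rfl fun v _ => G.adjugate_laplacian_apply w v

theorem laplacian_apply [Fintype E] [CommRing R] (w : E → R) (u v : V) :
    G.laplacian w u v = (if u = v then G.weightedDegree w u else 0) -
      ∑ e, if G.tail e = u ∧ G.head e = v then w e else 0 := by
  rw [laplacian, of_apply, Finset.sum_apply]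
  simp only [Pi.smul_apply, Pi.sub_apply, smul_eq_mul, mul_sub, Finset.sum_sub_distrib,
    weightedDegree, ite_and, ← Finset.sum_filter (fun e => G.tail e = u), Pi.single_apply]
  congr 1
  · rw [← Finset.sum_mul]
    simp [eq_comm]
  · simp [eq_comm]

/-! ### Passing to the line digraph -/

theorem weightedDegree_lineDigraph [Fintype E] [DecidableEq E] [CommRing R] (w : E → R) (e : E) :
    G.lineDigraph.weightedDegree (G.lineDigraph.inducedWeight w) e =
      G.weightedDegree w (G.head e) := by
  refine Finset.sum_bij (fun p _ => p.1.2) ?_ ?_ ?_ fun _ _ => rfl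
  · rintro ⟨⟨a, b⟩, hab⟩ hp
    obtain rfl : a = e := (Finset.mem_filter.1 hp).2
    exact Finset.mem_filter.2 ⟨Finset.mem_univ _, hab.symm⟩
  · rintro ⟨⟨a, b⟩, hab⟩ hp ⟨⟨a', b'⟩, hab'⟩ hp' (rfl : b = b')
    obtain rfl : a = e := (Finset.mem_filter.1 hp).2
    obtain rfl : a' = a := (Finset.mem_filter.1 hp').2
    rfl
  · intro f hf
    exact ⟨⟨(e, f), (Finset.mem_filter.1 hf).2.symm⟩,
      Finset.mem_filter.2 ⟨Finset.mem_univ _, rfl⟩, rfl⟩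

theorem adjacency_lineDigraph [Fintype E] [DecidableEq E] [CommRing R] (w : E → R) (e f : E) :
    (∑ p, if G.lineDigraph.tail p = e ∧ G.lineDigraph.head p = f then
      G.lineDigraph.inducedWeight w p else 0) = if G.head e = G.tail f then w f else 0 := by
  split_ifs with h
  · rw [Finset.sum_eq_single ⟨(e, f), h⟩]
    · exact if_pos ⟨rfl, rfl⟩
    · rintro ⟨⟨a, b⟩, hab⟩ - hne
      refine if_neg ?_
      rintro ⟨rfl : a = e, rfl : b = f⟩
      exact hne rfl
    · exact fun h => absurd (Finset.mem_univ _) h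
  · refine Finset.sum_eq_zero ?_
    rintro ⟨⟨a, b⟩, hab⟩ -
    refine if_neg ?_
    rintro ⟨rfl : a = e, rfl : b = f⟩
    exact h hab

theorem laplacianPoly_lineDigraph [Fintype V] [Fintype E] [DecidableEq E] [CommRing R]
    (w : E → R) (hG : ∀ v, 0 < G.indegree v) :
    G.lineDigraph.laplacianPoly (G.lineDigraph.inducedWeight w) =
      (∏ v, (X + C (G.weightedDegree w v)) ^ (G.indegree v - 1)) * G.laplacianPoly w := by
  classical
  let H : Matrix E V R[X] := of fun e v => if G.head e = v then 1 else 0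
  let W : Matrix V E R[X] := of fun v f => if G.tail f = v then C (w f) else 0
  let q : V → R[X] := fun v => X + C (G.weightedDegree w v)
  have hline : scalar E (X : R[X]) +
      (G.lineDigraph.laplacian (G.lineDigraph.inducedWeight w)).map C =
      diagonal (fun e => q (G.head e)) - H * W := by
    ext1 e f
    have hHW : (H * W) e f = C (if G.head e = G.tail f then w f else 0) := by
      simp [H, W, mul_apply, apply_ite C, eq_comm]
    rw [Matrix.sub_apply, hHW, Matrix.add_apply, map_apply, laplacian_apply, adjacency_lineDigraph,
      weightedDegree_lineDigraph, map_sub, ← add_sub_assoc]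
    congr 1
    by_cases h : e = f <;> simp [h, q]
  have hbase : scalar V (X : R[X]) + (G.laplacian w).map C = diagonal q - W * H := by
    ext1 u v
    have hWH : (W * H) u v = C (∑ e, if G.tail e = u ∧ G.head e = v then w e else 0) := by
      rw [map_sum]
      refine Finset.sum_congr rfl fun e _ => ?_
      by_cases h1 : G.tail e = u <;> by_cases h2 : G.head e = v <;> simp [H, W, h1, h2]
    rw [Matrix.sub_apply, hWH, Matrix.add_apply, map_apply, laplacian_apply, map_sub, ← add_sub_assoc]
    congr 1
    by_cases h : u = v <;> simp [h, q]
  have hcomm : diagonal (fun e => q (G.head e)) * H = H * diagonal q := by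
    ext1 e v
    rw [diagonal_mul, mul_diagonal]
    by_cases h : G.head e = v <;> simp [H, h]
  -- The upper right block vanishes by `hcomm`; taking determinants relates `H * W` to `W * H`.
  have hblock : fromBlocks (diagonal fun e => q (G.head e)) H W 1 *
      fromBlocks 1 (-H) 0 (diagonal q) =
      fromBlocks (diagonal fun e => q (G.head e)) 0 W (diagonal q - W * H) := by
    rw [fromBlocks_multiply]
    congr 1
    · simp
    · rw [Matrix.mul_neg, hcomm, neg_add_cancel]
    · simp
    · rw [Matrix.mul_neg, Matrix.one_mul, neg_add_eq_sub]
  have hdet := congrArg det hblock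
  rw [det_mul, det_fromBlocks_one₂₂, det_fromBlocks_zero₂₁, det_fromBlocks_zero₁₂, det_one,
    one_mul, det_diagonal, det_diagonal, ← hline, ← hbase,
    ← Finset.prod_fiberwise Finset.univ G.head] at hdet
  have hfiber : ∏ v, ∏ e with G.head e = v, q (G.head e) =
      (∏ v, q v ^ (G.indegree v - 1)) * ∏ v, q v := by
    rw [← Finset.prod_mul_distrib]
    refine Finset.prod_congr rfl fun v _ => ?_
    rw [← pow_succ, Nat.sub_add_cancel (hG v), indegree]
    exact Finset.prod_eq_pow_card fun e he => by rw [(Finset.mem_filter.1 he).2]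
  have hmonic : (∏ v, q v).Monic := monic_prod_of_monic _ _ fun v _ => monic_X_add_C _
  -- Thanks to the variable `X` the extra factor is monic, hence cancellable over any commutative
  -- ring, even if some weighted degrees are zero divisors.
  refine hmonic.isRegular.right ?_
  change _ * _ = _ * _
  rw [laplacianPoly, laplacianPoly, hdet, hfiber]
  ring

end

end MultiDigraph

open MultiDigraph in
theorem mainTheorem7 {V E R : Type*} [Fintype V] [DecidableEq V] [Fintype E] [DecidableEq E]
    [CommRing R] (G : MultiDigraph V E) (w : E → R) (hG : ∀ v, 0 < G.indegree v) :
    ∑ e : E, G.lineDigraph.treeEnumerator (G.lineDigraph.inducedWeight w) e =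
      (∏ v : V, G.weightedDegree w v ^ (G.indegree v - 1)) *
        ∑ v : V, G.treeEnumerator w v := by
  -- For empty `V` the determinant is `1`, so its constant coefficient need not vanish.
  rcases isEmpty_or_nonempty V with hV | hV
  · have : IsEmpty E := ⟨fun e => hV.false (G.tail e)⟩
    simp
  · rw [← coeff_one_laplacianPoly, ← coeff_one_laplacianPoly, laplacianPoly_lineDigraph G w hG,
      mul_coeff_one, coeff_zero_laplacianPoly, mul_zero, add_zero]
    congr 1
    simp [coeff_zero_eq_eval_zero, eval_prod]
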